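/- **Theorem.** Let $\mathcal{G}$ be a non-empty Hausdorff ample groupoid with source and range maps $s, r$ and unit space $\mathcal{G}^{(0)}$; that is, $\mathcal{G}$ is a Hausdorff topological groupoid, $\mathcal{G}^{(0)}$ is locally compact and Hausdorff, $s\colon\mathcal{G}\to\mathcal{G}^{(0)}$ is a local homeomorphism, and the topology of $\mathcal{G}$ has a basis of compact (open) bisections, a bisection being a subset of $\mathcal{G}$ on which both $s$ and $r$ are injective. Let $R$ be a commutative ring with identity. Let $A_R(\mathcal{G})$ be the Steinberg algebra: the $R$-module of all locally constant, compactly supported functions $\mathcal{G}\to R$ with pointwise addition and the convolution product $$(f*g)(b)=\sum_{r(c)=r(b)} f(c)\,g(c^{-1}b).$$ Then the ring $A_R(\mathcal{G})$ is simple (that is, it is non-zero and its only two-sided ideals are $0$ and itself) if and only if all of the following hold: 1. $\mathcal{G}$ is effective, i.e. the interior of $\{b\in\mathcal{G} : r(b)=s(b)\}$ is $\mathcal{G}^{(0)}$; 2. $\mathcal{G}$ is minimal, i.e. the only open sets $U\subseteq\mathcal{G}^{(0)}$ such that $s(b)\in U$ implies $r(b)\in U$ for all $b\in\mathcal{G}$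 are $\emptyset$ and $\mathcal{G}^{(0)}$; 3. $R$ is a field. -/

import Mathlib

open CategoryTheory Topology

universe v u w

/-!
A (small) groupoid is Mathlib's `CategoryTheory.Groupoid X`; `X` is the unit space and
`Quiver.Total X` is the set of all arrows.  An arrow `b` has source `b.left` and range `b.right`.
-/

namespace AmpleGroupoid

section Operations

variable {X : Type u} [Groupoid.{v} X]

/-- The source map `s`. -/
def src (b : Quiver.Total X) : X := b.left

/-- The range map `r`. -/
def rng (b : Quiver.Total X) : X := b.right

/-- The unit arrow at a point of the unit space. -/
def unit (x : X) : Quiver.Total X := ⟨x, x, 𝟙 x⟩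

/-- The inverse of an arrow. -/
def inv (b : Quiver.Total X) : Quiver.Total X := ⟨b.right, b.left, Groupoid.inv b.hom⟩

/-- The product `c d`, defined when `s(c) = r(d)`: first `d`, then `c`. -/
def prod (c d : Quiver.Total X) (h : src c = rng d) : Quiver.Total X :=
  ⟨d.left, c.right, d.hom ≫ eqToHom h.symm ≫ c.hom⟩

/-- A bisection: a set of arrows on which both the source and the range map are injective. -/
def IsBisection (B : Set (Quiver.Total X)) : Prop :=
  Set.InjOn src B ∧ Set.InjOn rng B

variable (X) in
/-- The isotropy subgroupoid. -/
def isotropy : Set (Quiver.Total X) := {b | rng b = src b}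

end Operations

/-- A topological groupoid: all structure maps are continuous.  The topology of the unit space
is then the one induced by `unit` from the space of arrows, because `src ∘ unit = id`. -/
class IsTopologicalGroupoid (X : Type u) [Groupoid.{v} X] [TopologicalSpace X]
    [TopologicalSpace (Quiver.Total X)] : Prop where
  continuous_src : Continuous (src : Quiver.Total X → X)
  continuous_rng : Continuous (rng : Quiver.Total X → X)
  continuous_unit : Continuous (unit : X → Quiver.Total X)
  continuous_inv : Continuous (inv : Quiver.Total X → Quiver.Total X)
  continuous_prod : Continuous
    fun p : {p : Quiver.Total X × Quiver.Total X // src p.1 = rng p.2} =>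
      prod p.1.1 p.1.2 p.2

/-- An étale groupoid: the unit space is locally compact and Hausdorff, and the source map is a
local homeomorphism. -/
class IsEtale (X : Type u) [Groupoid.{v} X] [TopologicalSpace X]
    [TopologicalSpace (Quiver.Total X)] : Prop extends IsTopologicalGroupoid X where
  locallyCompact_units : LocallyCompactSpace X
  t2_units : T2Space X
  isLocalHomeomorph_src : IsLocalHomeomorph (src : Quiver.Total X → X)

/-- An ample groupoid: an étale groupoid whose topology has a basis of compact bisections. -/
class IsAmple (X : Type u) [Groupoid.{v} X] [TopologicalSpace X]
    [TopologicalSpace (Quiver.Total X)] : Prop extends IsEtale X where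
  isTopologicalBasis : TopologicalSpace.IsTopologicalBasis
    {B : Set (Quiver.Total X) | IsOpen B ∧ IsCompact B ∧ IsBisection B}

/-- A set of units is invariant if `s(b) ∈ U` implies `r(b) ∈ U`. -/
def IsInvariant {X : Type u} [Groupoid.{v} X] (U : Set X) : Prop :=
  ∀ b : Quiver.Total X, src b ∈ U → rng b ∈ U

/-- The groupoid is minimal: the only open invariant sets of units are `∅` and everything. -/
def IsMinimal (X : Type u) [Groupoid.{v} X] [TopologicalSpace X] : Prop :=
  ∀ U : Set X, IsOpen U → IsInvariant U → U = ∅ ∨ U = Set.univ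

/-- The groupoid is effective: the interior of the isotropy is the set of units. -/
def IsEffective (X : Type u) [Groupoid.{v} X] [TopologicalSpace (Quiver.Total X)] : Prop :=
  interior (isotropy X) = Set.range (unit : X → Quiver.Total X)

/-- The convolution product `(f * g)(b) = ∑_{r(c) = r(b)} f(c) g(c⁻¹ b)`. -/
noncomputable def conv {R : Type w} [CommRing R] {X : Type u} [Groupoid.{v} X]
    (f g : Quiver.Total X → R) (b : Quiver.Total X) : R :=
  ∑ᶠ c : {c : Quiver.Total X // rng c = rng b}, f c.1 * g (prod (inv c.1) b c.2)

/-- The Steinberg algebra as an `R`-module: the locally constant, compactly supported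
functions from the space of arrows to `R`.  (Its convolution product is the instance below.) -/
def SteinbergAlgebra (R : Type w) [CommRing R] (X : Type u) [Groupoid.{v} X]
    [TopologicalSpace (Quiver.Total X)] : Submodule R (Quiver.Total X → R) where
  carrier := {f | IsLocallyConstant f ∧ HasCompactSupport f}
  zero_mem' := ⟨IsLocallyConstant.const 0, HasCompactSupport.zero⟩
  add_mem' hf hg := ⟨hf.1.add hg.1, hf.2.add hg.2⟩
  smul_mem' r _ hf := ⟨hf.1.comp (fun x => r • x), hf.2.comp_left (smul_zero r)⟩

section Facts

set_option linter.unusedSectionVars false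

variable {R : Type w} [CommRing R] {X : Type u} [Groupoid.{v} X]

theorem prod_mk {x y z : X} (c : y ⟶ z) (d : x ⟶ y) (h : src ⟨y, z, c⟩ = rng ⟨x, y, d⟩) :
    prod ⟨y, z, c⟩ ⟨x, y, d⟩ h = ⟨x, z, d ≫ c⟩ := by
  simp only [prod]
  congr 1
  exact congrArg (d ≫ ·) (Category.id_comp c)

theorem inv_mk {x y : X} (c : x ⟶ y) :
    inv (⟨x, y, c⟩ : Quiver.Total X) = ⟨y, x, Groupoid.inv c⟩ := rfl

theorem prod_inv_right (c b : Quiver.Total X) (h : rng c = rng b) :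
    rng (prod (inv c) b h) = src c := rfl

theorem prod_inv_prod (c b : Quiver.Total X) (h : rng c = rng b) :
    prod c (prod (inv c) b h) rfl = b := by
  obtain ⟨x, y, c⟩ := c
  obtain ⟨x', y', b⟩ := b
  change y = y' at h
  subst h
  simp only [inv_mk, prod_mk]
  simp

/-- The convolution formula, with the sum indexed by the arrows into the range of `b`. -/
theorem conv_mk (f g : Quiver.Total X → R) {x y : X} (b : x ⟶ y) :
    conv f g ⟨x, y, b⟩ =
      ∑ᶠ c : (Σ z, (z ⟶ y)), f ⟨c.1, y, c.2⟩ * g ⟨x, c.1, b ≫ Groupoid.inv c.2⟩ := by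
  let e : (Σ z, (z ⟶ y)) ≃ {c : Quiver.Total X // rng c = rng ⟨x, y, b⟩} :=
    { toFun := fun c => ⟨⟨c.1, y, c.2⟩, rfl⟩
      invFun := fun c => ⟨c.1.left, c.1.hom ≫ eqToHom c.2⟩
      left_inv := fun c => by simp
      right_inv := by
        rintro ⟨⟨z, y', c⟩, h⟩
        change y' = y at h
        subst h
        exact Subtype.ext (congrArg (Quiver.Total.mk z y') (Category.comp_id c)) }
  rw [conv, ← finsum_comp_equiv e]
  refine finsum_congr fun c => ?_
  simp only [e, Equiv.coe_fn_mk, inv_mk, prod_mk]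

theorem conv_eq_of_bisection {f g : Quiver.Total X → R} {B : Set (Quiver.Total X)}
    (hB : IsBisection B) (hfB : ∀ b, b ∉ B → f b = 0) {c b : Quiver.Total X} (hc : c ∈ B)
    (h : rng c = rng b) : conv f g b = f c * g (prod (inv c) b h) := by
  refine finsum_eq_single _ (⟨c, h⟩ : {c : Quiver.Total X // rng c = rng b}) fun d hd => ?_
  have : d.1 ∉ B := fun hdB => hd (Subtype.ext (hB.2 hdB hc (d.2.trans h.symm)))
  rw [hfB _ this, zero_mul]

variable [TopologicalSpace X] [TopologicalSpace (Quiver.Total X)]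

theorem isOpenMap_rng [IsEtale X] : IsOpenMap (rng : Quiver.Total X → X) := by
  have hinv : ∀ b : Quiver.Total X, inv (inv b) = b := fun b => by simp [inv]
  have h : IsOpenMap (inv : Quiver.Total X → Quiver.Total X) := by
    intro U hU
    rw [Set.image_eq_preimage_of_inverse hinv hinv]
    exact hU.preimage IsTopologicalGroupoid.continuous_inv
  exact (IsEtale.isLocalHomeomorph_src (X := X)).isOpenMap.comp h

variable [T2Space (Quiver.Total X)] [IsAmple X]

/-- Induction principle: an additive property of the elements of the Steinberg algebra holds as
soon as it holds for those supported in a compact open bisection. -/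
theorem induction_bisection {P : (Quiver.Total X → R) → Prop} (h0 : P 0)
    (hadd : ∀ f ∈ SteinbergAlgebra R X, ∀ g ∈ SteinbergAlgebra R X, P f → P g → P (f + g))
    (hB : ∀ (B : Set (Quiver.Total X)), IsOpen B → IsCompact B → IsBisection B →
      ∀ f ∈ SteinbergAlgebra R X, (∀ b, b ∉ B → f b = 0) → P f)
    (f : Quiver.Total X → R) (hf : f ∈ SteinbergAlgebra R X) : P f := by
  classical
  have key : ∀ t : Finset (Set (Quiver.Total X)),
      (∀ B ∈ t, IsOpen B ∧ IsCompact B ∧ IsBisection B) →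
      ∀ f ∈ SteinbergAlgebra R X, (∀ b, (∀ B ∈ t, b ∉ B) → f b = 0) → P f := by
    intro t
    induction t using Finset.induction_on with
    | empty =>
      intro _ f _ h
      have : f = 0 := funext fun b => h b (by simp)
      rwa [this]
    | insert B t _ ih =>
      intro ht f hf h
      obtain ⟨hBo, hBc, hBb⟩ := ht B (Finset.mem_insert_self _ _)
      have hcl : IsClopen B := ⟨hBc.isClosed, hBo⟩
      have hmem : ∀ C : Set (Quiver.Total X), IsClopen C →
          C.indicator f ∈ SteinbergAlgebra R X := by
        intro C hC
        refine ⟨?_, hf.2.mono ?_⟩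
        · rw [IsLocallyConstant.iff_eventually_eq]
          intro b
          have hfb := hf.1.eventually_eq b
          by_cases hb : b ∈ C
          · filter_upwards [hfb, hC.isOpen.mem_nhds hb] with c hc hcC
            rw [Set.indicator_of_mem hcC, Set.indicator_of_mem hb, hc]
          · filter_upwards [hC.compl.isOpen.mem_nhds hb] with c hcC
            rw [Set.indicator_of_notMem hcC, Set.indicator_of_notMem hb]
        · rw [Set.support_indicator]
          exact Set.inter_subset_right
      rw [← Set.indicator_self_add_compl B f]
      refine hadd _ (hmem _ hcl) _ (hmem _ hcl.compl) ?_ ?_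
      · exact hB B hBo hBc hBb _ (hmem _ hcl) fun b hb => Set.indicator_of_notMem hb f
      · refine ih (fun C hC => ht C (Finset.mem_insert_of_mem hC)) _ (hmem _ hcl.compl) ?_
        intro b hb
        by_cases hbB : b ∈ B
        · exact Set.indicator_of_notMem (by simpa using hbB) f
        · rw [Set.indicator_of_mem (by simpa using hbB)]
          exact h b fun C hC => by
            rcases Finset.mem_insert.1 hC with rfl | hC
            · exact hbB
            · exact hb C hC
  have hbas := IsAmple.isTopologicalBasis (X := X)
  obtain ⟨t, ht⟩ := hf.2.isCompact.elim_finite_subcover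
    (fun B : {B : Set (Quiver.Total X) // IsOpen B ∧ IsCompact B ∧ IsBisection B} => B.1)
    (fun B => B.2.1) (fun b _ => by
      obtain ⟨B, hB, hbB, -⟩ := hbas.exists_subset_of_mem_open (Set.mem_univ b) isOpen_univ
      exact Set.mem_iUnion.2 ⟨⟨B, hB⟩, hbB⟩)
  refine key (t.image Subtype.val) ?_ f hf ?_
  · intro B hB
    obtain ⟨C, -, rfl⟩ := Finset.mem_image.1 hB
    exact C.2
  · intro b hb
    by_contra hne
    obtain ⟨B, hBt, hbB⟩ := Set.mem_iUnion₂.1 (ht (subset_tsupport f hne))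
    exact hb B.1 (Finset.mem_image_of_mem _ hBt) hbB

/-- Only finitely many arrows of a given range lie in the support. -/
theorem finite_fiber {f : Quiver.Total X → R} (hf : f ∈ SteinbergAlgebra R X) (x : X) :
    {b : Quiver.Total X | rng b = x ∧ f b ≠ 0}.Finite := by
  refine induction_bisection (P := fun f => {b | rng b = x ∧ f b ≠ 0}.Finite) ?_ ?_ ?_ f hf
  · simp
  · intro f _ g _ h1 h2
    refine (h1.union h2).subset ?_
    rintro b ⟨hb, hne⟩
    by_cases h : f b = 0
    · exact Or.inr ⟨hb, fun h' => hne (by simp [h, h'])⟩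
    · exact Or.inl ⟨hb, h⟩
  · intro B _ _ hB f _ hfB
    refine Set.Subsingleton.finite ?_
    rintro b ⟨hb, hne⟩ c ⟨hc, hne'⟩
    exact hB.2 (not_imp_comm.1 (hfB b) hne) (not_imp_comm.1 (hfB c) hne') (hb.trans hc.symm)

theorem finite_support_subtype {f : Quiver.Total X → R} (hf : f ∈ SteinbergAlgebra R X) (x : X)
    (k : {c : Quiver.Total X // rng c = x} → R) :
    (Function.support fun c : {c : Quiver.Total X // rng c = x} => f c.1 * k c).Finite := by
  refine ((finite_fiber hf x).preimage Subtype.val_injective.injOn).subset ?_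
  exact fun c hc => ⟨c.2, left_ne_zero_of_mul hc⟩

theorem finite_support_sigma {f : Quiver.Total X → R} (hf : f ∈ SteinbergAlgebra R X) (y : X) :
    (Function.support fun c : (Σ z, (z ⟶ y)) => f ⟨c.1, y, c.2⟩).Finite := by
  have hinj : Function.Injective (fun c : (Σ z, (z ⟶ y)) => (⟨c.1, y, c.2⟩ : Quiver.Total X)) := by
    rintro ⟨z, c⟩ ⟨z', c'⟩ h
    simpa using h
  refine ((finite_fiber hf y).preimage hinj.injOn).subset ?_
  exact fun c hc => ⟨rfl, hc⟩

theorem conv_add_left {f f' : Quiver.Total X → R} (hf : f ∈ SteinbergAlgebra R X)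
    (hf' : f' ∈ SteinbergAlgebra R X) (g : Quiver.Total X → R) :
    conv (f + f') g = conv f g + conv f' g := by
  funext b
  simp only [conv, Pi.add_apply, add_mul]
  exact finsum_add_distrib (finite_support_subtype hf _ _) (finite_support_subtype hf' _ _)

theorem conv_add_right {f : Quiver.Total X → R} (hf : f ∈ SteinbergAlgebra R X)
    (g g' : Quiver.Total X → R) : conv f (g + g') = conv f g + conv f g' := by
  funext b
  simp only [conv, Pi.add_apply, mul_add]
  exact finsum_add_distrib (finite_support_subtype hf _ _) (finite_support_subtype hf _ _)

theorem conv_hasCompactSupport {f g : Quiver.Total X → R} (hf : f ∈ SteinbergAlgebra R X)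
    (hg : g ∈ SteinbergAlgebra R X) : HasCompactSupport (conv f g) := by
  have : T2Space X := IsEtale.t2_units
  let K : Set {p : Quiver.Total X × Quiver.Total X // src p.1 = rng p.2} :=
    Subtype.val ⁻¹' (tsupport f ×ˢ tsupport g)
  have hclosed : IsClosed {p : Quiver.Total X × Quiver.Total X | src p.1 = rng p.2} :=
    isClosed_eq (IsTopologicalGroupoid.continuous_src.comp continuous_fst)
      (IsTopologicalGroupoid.continuous_rng.comp continuous_snd)
  have hK : IsCompact K :=
    hclosed.isClosedEmbedding_subtypeVal.isCompact_preimage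
      (hf.2.isCompact.prod hg.2.isCompact)
  refine HasCompactSupport.intro
    (hK.image (IsTopologicalGroupoid.continuous_prod (X := X))) fun b hb => ?_
  refine finsum_eq_zero_of_forall_eq_zero fun c => ?_
  by_contra hne
  refine hb ⟨⟨(c.1, prod (inv c.1) b c.2), rfl⟩, ⟨?_, ?_⟩, prod_inv_prod c.1 b c.2⟩
  · exact subset_tsupport f (left_ne_zero_of_mul hne)
  · exact subset_tsupport g (right_ne_zero_of_mul hne)

theorem conv_isLocallyConstant_of_bisection {f g : Quiver.Total X → R}
    (hf : f ∈ SteinbergAlgebra R X) (hg : g ∈ SteinbergAlgebra R X)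
    {B : Set (Quiver.Total X)} (hBo : IsOpen B) (hBc : IsCompact B)
    (hB : IsBisection B) (hfB : ∀ b, b ∉ B → f b = 0) : IsLocallyConstant (conv f g) := by
  have : T2Space X := IsEtale.t2_units
  have hr : Continuous (rng : Quiver.Total X → X) := IsTopologicalGroupoid.continuous_rng
  rw [IsLocallyConstant.iff_eventually_eq]
  intro b
  by_cases hb : rng b ∈ rng '' B
  · obtain ⟨c, hcB, hcb⟩ := hb
    let Y := {p : Quiver.Total X × Quiver.Total X // rng p.1 = rng p.2}
    have hcont : Continuous fun p : Y => prod (inv p.1.1) p.1.2 p.2 := by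
      have h1 : Continuous fun p : Y =>
          (⟨(inv p.1.1, p.1.2), p.2⟩ :
            {p : Quiver.Total X × Quiver.Total X // src p.1 = rng p.2}) := by
        refine Continuous.subtype_mk ?_ _
        exact (IsTopologicalGroupoid.continuous_inv.comp
          (continuous_fst.comp continuous_subtype_val)).prodMk
            (continuous_snd.comp continuous_subtype_val)
      exact IsTopologicalGroupoid.continuous_prod.comp h1
    have hcont1 : Continuous fun p : Y => p.1.1 := continuous_fst.comp continuous_subtype_val
    have hev : ∀ᶠ p : Y in 𝓝 ⟨(c, b), hcb⟩, p.1.1 ∈ B ∧ f p.1.1 = f c ∧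
        g (prod (inv p.1.1) p.1.2 p.2) = g (prod (inv c) b hcb) :=
      (hcont1.continuousAt.eventually (hBo.mem_nhds hcB)).and
        (((hf.1.comp_continuous hcont1).eventually_eq ⟨(c, b), hcb⟩).and
          ((hg.1.comp_continuous hcont).eventually_eq ⟨(c, b), hcb⟩))
    rw [nhds_subtype_eq_comap, Filter.eventually_comap, nhds_prod_eq,
      Filter.eventually_prod_iff] at hev
    obtain ⟨P, hP, Q, hQ, hPQ⟩ := hev
    have himg : rng '' {d | P d} ∈ 𝓝 (rng b) := hcb ▸ isOpenMap_rng.image_mem_nhds hP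
    filter_upwards [hQ, hr.continuousAt himg] with b' hb' ⟨d, hd, hdb'⟩
    obtain ⟨hdB, h1, h2⟩ := hPQ hd hb' ⟨(d, b'), hdb'⟩ rfl
    rw [conv_eq_of_bisection hB hfB hdB hdb', conv_eq_of_bisection hB hfB hcB hcb]
    exact congrArg₂ _ h1 h2
  · have hzero : ∀ b', rng b' ∉ rng '' B → conv f g b' = 0 := fun b' hb' =>
      finsum_eq_zero_of_forall_eq_zero fun c => by
        rw [hfB c.1 fun hc => hb' ⟨c.1, hc, c.2⟩, zero_mul]
    filter_upwards [((hBc.image hr).isClosed.isOpen_compl.preimage hr).mem_nhds hb] with b' hb'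
    rw [hzero b hb, hzero b' hb']

/-- The Steinberg algebra is closed under convolution. -/
theorem conv_mem {f g : Quiver.Total X → R} (hf : f ∈ SteinbergAlgebra R X)
    (hg : g ∈ SteinbergAlgebra R X) : conv f g ∈ SteinbergAlgebra R X := by
  refine ⟨?_, conv_hasCompactSupport hf hg⟩
  refine induction_bisection (P := fun f => IsLocallyConstant (conv f g)) ?_ ?_ ?_ f hf
  · refine IsLocallyConstant.of_constant _ fun a b => ?_
    simp [conv]
  · intro f hf f' hf' h h'
    rw [conv_add_left hf hf']
    exact h.add h'
  · intro B hBo hBc hB f hf hfB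
    exact conv_isLocallyConstant_of_bisection hf hg hBo hBc hB hfB

theorem conv_assoc {f g : Quiver.Total X → R} (hf : f ∈ SteinbergAlgebra R X)
    (hg : g ∈ SteinbergAlgebra R X) (h : Quiver.Total X → R) :
    conv (conv f g) h = conv f (conv g h) := by
  classical
  funext b
  obtain ⟨x, y, b⟩ := b
  have hD := finite_support_sigma hf y
  have hsub : ∀ k : (Σ z, (z ⟶ y)) → R,
      (Function.support fun d => f ⟨d.1, y, d.2⟩ * k d) ⊆ hD.toFinset := by
    intro k d hd
    simpa using left_ne_zero_of_mul hd
  have hl : ∀ c : (Σ z, (z ⟶ y)),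
      conv f g ⟨c.1, y, c.2⟩ * h ⟨x, c.1, b ≫ Groupoid.inv c.2⟩ =
        ∑ d ∈ hD.toFinset, f ⟨d.1, y, d.2⟩ * (g ⟨c.1, d.1, c.2 ≫ Groupoid.inv d.2⟩ *
          h ⟨x, c.1, b ≫ Groupoid.inv c.2⟩) := by
    intro c
    rw [conv_mk, finsum_eq_sum_of_support_subset _ (hsub _), Finset.sum_mul]
    simp only [mul_assoc]
  let e : ∀ d : (Σ z, (z ⟶ y)), (Σ z, (z ⟶ d.1)) ≃ (Σ z, (z ⟶ y)) := fun d =>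
    Equiv.sigmaCongrRight fun z =>
      { toFun := fun c => c ≫ d.2
        invFun := fun c => c ≫ Groupoid.inv d.2
        left_inv := fun c => by simp
        right_inv := fun c => by simp }
  have he : ∀ d c, (⟨((e d) c).1, d.1, ((e d) c).2 ≫ Groupoid.inv d.2⟩ : Quiver.Total X) =
      ⟨c.1, d.1, c.2⟩ := fun d c =>
    congrArg (Quiver.Total.mk c.1 d.1) (show (c.2 ≫ d.2) ≫ Groupoid.inv d.2 = c.2 by simp)
  have he' : ∀ d c, (⟨x, ((e d) c).1, b ≫ Groupoid.inv ((e d) c).2⟩ : Quiver.Total X) =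
      ⟨x, c.1, (b ≫ Groupoid.inv d.2) ≫ Groupoid.inv c.2⟩ := fun d c =>
    congrArg (Quiver.Total.mk x c.1) (show b ≫ Groupoid.inv (c.2 ≫ d.2) =
      (b ≫ Groupoid.inv d.2) ≫ Groupoid.inv c.2 by simp)
  have hG : ∀ (d : (Σ z, (z ⟶ y))) (k : (Σ z, (z ⟶ d.1)) → R),
      (Function.support fun c : (Σ z, (z ⟶ d.1)) => g ⟨c.1, d.1, c.2⟩ * k c).Finite :=
    fun d k => (finite_support_sigma hg d.1).subset fun c hc => left_ne_zero_of_mul hc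
  have hr : ∀ d : (Σ z, (z ⟶ y)),
      ∑ᶠ c : (Σ z, (z ⟶ y)), f ⟨d.1, y, d.2⟩ * (g ⟨c.1, d.1, c.2 ≫ Groupoid.inv d.2⟩ *
          h ⟨x, c.1, b ≫ Groupoid.inv c.2⟩) =
        f ⟨d.1, y, d.2⟩ * conv g h ⟨x, d.1, b ≫ Groupoid.inv d.2⟩ := by
    intro d
    rw [← finsum_comp_equiv (e d), conv_mk, mul_finsum' _ _ (hG d _)]
    simp only [he, he']
  rw [conv_mk, conv_mk]
  simp only [hl]
  rw [finsum_sum_comm, finsum_eq_sum_of_support_subset _ (hsub _)]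
  · exact Finset.sum_congr rfl fun d _ => hr d
  · intro d _
    refine ((hG d fun c => h ⟨x, c.1, (b ≫ Groupoid.inv d.2) ≫ Groupoid.inv c.2⟩).image
      (e d)).subset ?_
    intro c hc
    refine ⟨(e d).symm c, ?_, (e d).apply_symm_apply c⟩
    have hc' := right_ne_zero_of_mul hc
    rw [← (e d).apply_symm_apply c, he, he'] at hc'
    exact hc'

end Facts

section Ring

variable (R : Type w) [CommRing R] (X : Type u) [Groupoid.{v} X]
  [TopologicalSpace X] [TopologicalSpace (Quiver.Total X)] [T2Space (Quiver.Total X)] [IsAmple X]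

/-- The (in general non-unital) ring structure of the Steinberg algebra: pointwise addition and
convolution. -/
noncomputable instance : NonUnitalRing (SteinbergAlgebra R X) :=
  { (inferInstance : AddCommGroup (SteinbergAlgebra R X)) with
    mul := fun f g => ⟨conv f.1 g.1, conv_mem f.2 g.2⟩
    left_distrib := fun f g h => Subtype.ext (conv_add_right f.2 g.1 h.1)
    right_distrib := fun f g h => Subtype.ext (conv_add_left f.2 g.2 h.1)
    zero_mul := fun f => Subtype.ext (funext fun b => by
      change conv 0 f.1 b = 0
      simp [conv])
    mul_zero := fun f => Subtype.ext (funext fun b => by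
      change conv f.1 0 b = 0
      simp [conv])
    mul_assoc := fun f g h => Subtype.ext (conv_assoc f.2 g.2 h.1) }

theorem coe_mul (f g : SteinbergAlgebra R X) :
    ((f * g : SteinbergAlgebra R X) : Quiver.Total X → R) = conv f.1 g.1 := rfl

noncomputable instance : IsScalarTower R (SteinbergAlgebra R X) (SteinbergAlgebra R X) :=
  ⟨fun r f g => Subtype.ext (funext fun b => by
    change conv (r • f.1) g.1 b = r * conv f.1 g.1 b
    simp only [conv, Pi.smul_apply, smul_eq_mul, mul_assoc]
    exact (mul_finsum' _ _ (finite_support_subtype f.2 _ _)).symm)⟩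

noncomputable instance : SMulCommClass R (SteinbergAlgebra R X) (SteinbergAlgebra R X) :=
  ⟨fun r f g => Subtype.ext (funext fun b => by
    change r * conv f.1 g.1 b = conv f.1 (r • g.1) b
    simp only [conv, Pi.smul_apply, smul_eq_mul, mul_left_comm _ r]
    exact mul_finsum' _ _ (finite_support_subtype f.2 _ _))⟩

end Ring

end AmpleGroupoid

/-! Write `1_K` for the indicator of a compact open set `K` of units. Multiplying by `1_K` on the
left or right restricts a function to arrows with range or source in `K`.

Sufficiency: translate a nonzero `f` in an ideal `I` by a bisection to get `g ∈ I` with a nonzero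
value `t` at a unit. Effectiveness gives a small `K` on which `g` is `t` at the units and zero at
every other arrow with both ends in `K` (`IsEffective.exists_open_vanishing`), so `1_K * g * 1_K = t
• 1_K`. As `t` is invertible, `1_K ∈ I`. The units covered by such `K` form an open set, invariant
under conjugation by bisections, hence everything by minimality. Then `I` contains every `1_K`, and
these act as local units.

Necessity: each failure yields a proper nonzero ideal: the multiples of a nonzero non-invertible
scalar, the functions supported over an invariant open set, or `actionKernel`. The last is the
kernel of the action on functions on the unit space; it contains `1_B - 1_{r(B)}` for every compact
open bisection `B` inside the isotropy. -/

namespace AmpleGroupoid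

/-! ### Algebra of arrows -/

section Arrows

variable {X : Type u} [Groupoid.{v} X]

theorem src_unit (x : X) : src (unit x) = x := rfl

theorem rng_unit (x : X) : rng (unit x) = x := rfl

theorem inv_inv (b : Quiver.Total X) : inv (inv b) = b := by simp [inv]

theorem unit_injective : Function.Injective (unit : X → Quiver.Total X) :=
  Function.LeftInverse.injective src_unit

theorem prod_unit (c : Quiver.Total X) (x : X) (h : src c = rng (unit x)) :
    prod c (unit x) h = c := by
  obtain ⟨y, z, c⟩ := c
  change y = x at h
  subst h
  exact (prod_mk c (𝟙 y) rfl).trans (by rw [Category.id_comp])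

theorem prod_inv_unit (b : Quiver.Total X) (x : X) (h : rng b = x) :
    prod (inv b) (unit x) h = inv b :=
  prod_unit _ _ _

theorem prod_inv_unit_left (b : Quiver.Total X) (x : X) (h : x = rng b) :
    prod (inv (unit x)) b h = b := by
  subst h
  obtain ⟨y, z, b⟩ := b
  exact (prod_mk (Groupoid.inv (𝟙 z)) b rfl).trans (by simp)

theorem prod_inv_self (b : Quiver.Total X) : prod b (inv b) rfl = unit (rng b) := by
  obtain ⟨y, z, b⟩ := b
  exact (prod_mk b (Groupoid.inv b) rfl).trans (by simp [unit, rng])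

theorem eq_of_prod_inv_mem_range_unit {c b : Quiver.Total X} {h : rng c = rng b}
    (hu : prod (inv c) b h ∈ Set.range (unit : X → Quiver.Total X)) : c = b := by
  obtain ⟨x, hx⟩ := hu
  -- `prod` carries a proof of composability, so the second factor is generalised before
  -- substituting.
  have key : ∀ (e : Quiver.Total X) (he : src c = rng e), unit x = e → prod c e he = c := by
    rintro _ he rfl
    exact prod_unit c x he
  rw [← key _ rfl hx, prod_inv_prod]

/-- The hypothesis says `c⁻¹d = c⁻¹`; multiply by `c` on the left. -/
theorem eq_unit_of_inv_prod_inv {c d : Quiver.Total X} {h : rng c = rng d}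
    (hcd : inv (prod (inv c) d h) = c) : d = unit (rng d) := by
  have key : ∀ (e : Quiver.Total X) (he : src c = rng e), inv c = e →
      prod c e he = unit (rng c) := by
    rintro _ _ rfl
    exact prod_inv_self c
  have hd := key (prod (inv c) d h) rfl ((congrArg inv hcd).symm.trans (inv_inv _))
  rw [prod_inv_prod, h] at hd
  exact hd

end Arrows

theorem IsBisection.mono {X : Type u} [Groupoid.{v} X] {B C : Set (Quiver.Total X)}
    (hC : IsBisection C) (h : B ⊆ C) : IsBisection B :=
  ⟨hC.1.mono h, hC.2.mono h⟩

theorem isBisection_image_unit {X : Type u} [Groupoid.{v} X] (K : Set X) :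
    IsBisection (unit '' K) := by
  constructor
  · rintro _ ⟨x, -, rfl⟩ _ ⟨y, -, rfl⟩ h
    exact congrArg unit h
  · rintro _ ⟨x, -, rfl⟩ _ ⟨y, -, rfl⟩ h
    exact congrArg unit h

/-! ### Topology of the unit space and of bisections -/

section Topological

variable {X : Type u} [Groupoid.{v} X] [TopologicalSpace X] [TopologicalSpace (Quiver.Total X)]

/-- A continuous section of a local homeomorphism is an open embedding. -/
theorem isOpenEmbedding_unit [IsEtale X] : IsOpenEmbedding (unit : X → Quiver.Total X) :=
  (IsEtale.isLocalHomeomorph_src (X := X)).isOpenEmbedding_of_comp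
    (f := unit) IsOpenEmbedding.id IsTopologicalGroupoid.continuous_unit

theorem isOpenMap_src [IsEtale X] : IsOpenMap (src : Quiver.Total X → X) :=
  (IsEtale.isLocalHomeomorph_src (X := X)).isOpenMap

theorem isClosed_range_unit [T2Space (Quiver.Total X)] [IsEtale X] :
    IsClosed (Set.range (unit : X → Quiver.Total X)) := by
  have : Set.range (unit : X → Quiver.Total X) = {b | unit (src b) = b} := by
    ext b
    constructor
    · rintro ⟨x, rfl⟩
      rfl
    · exact fun h => ⟨_, h⟩
  rw [this]
  exact isClosed_eq
    (IsTopologicalGroupoid.continuous_unit.comp IsTopologicalGroupoid.continuous_src)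
    continuous_id

theorem exists_compact_open_bisection [IsAmple X] {b : Quiver.Total X} {U : Set (Quiver.Total X)}
    (hU : IsOpen U) (hb : b ∈ U) :
    ∃ B, IsOpen B ∧ IsCompact B ∧ IsBisection B ∧ b ∈ B ∧ B ⊆ U := by
  obtain ⟨B, ⟨h1, h2, h3⟩, h4, h5⟩ :=
    (IsAmple.isTopologicalBasis (X := X)).exists_subset_of_mem_open hb hU
  exact ⟨B, h1, h2, h3, h4, h5⟩

/-- Since `src` is open and continuous, it carries compact open bisections around `unit x` to
compact open sets of units. -/
theorem exists_compact_open [IsAmple X] {x : X} {U : Set X} (hU : IsOpen U) (hx : x ∈ U) :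
    ∃ K, IsOpen K ∧ IsCompact K ∧ x ∈ K ∧ K ⊆ U := by
  obtain ⟨B, h1, h2, -, h4, h5⟩ := exists_compact_open_bisection (b := unit x)
    (hU.preimage (IsTopologicalGroupoid.continuous_src (X := X))) hx
  exact ⟨src '' B, isOpenMap_src _ h1, h2.image IsTopologicalGroupoid.continuous_src,
    ⟨_, h4, rfl⟩, Set.image_subset_iff.2 h5⟩

theorem isOpen_preimage_inv [IsEtale X] {B : Set (Quiver.Total X)} (hB : IsOpen B) :
    IsOpen (inv ⁻¹' B) :=
  hB.preimage IsTopologicalGroupoid.continuous_inv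

theorem isCompact_preimage_inv [IsEtale X] {B : Set (Quiver.Total X)} (hB : IsCompact B) :
    IsCompact (inv ⁻¹' B) := by
  rw [← Set.image_eq_preimage_of_inverse inv_inv inv_inv]
  exact hB.image IsTopologicalGroupoid.continuous_inv

end Topological

/-! ### Indicator functions and their convolutions -/

section Indicator

variable {R : Type w} [CommRing R] {X : Type u} [Groupoid.{v} X]

/-- A bisection has at most one arrow into each unit, so the sum has one term: left convolution by
the indicator of `B` is translation. -/
theorem conv_indicator_of_mem {B : Set (Quiver.Total X)} (hB : IsBisection B)
    (g : Quiver.Total X → R) {c b : Quiver.Total X} (hc : c ∈ B) (h : rng c = rng b) :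
    conv (B.indicator 1) g b = g (prod (inv c) b h) := by
  rw [conv_eq_of_bisection hB (fun b hb => Set.indicator_of_notMem hb _) hc h,
    Set.indicator_of_mem hc, Pi.one_apply, one_mul]

variable (R) [TopologicalSpace (Quiver.Total X)] [T2Space (Quiver.Total X)]

/-- The indicator function of a compact open set of arrows. -/
noncomputable def indicatorOf (B : Set (Quiver.Total X)) (ho : IsOpen B) (hc : IsCompact B) :
    SteinbergAlgebra R X :=
  ⟨B.indicator 1, by
    classical
    refine ⟨?_, HasCompactSupport.intro hc fun b hb => Set.indicator_of_notMem hb _⟩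
    rw [IsLocallyConstant.iff_eventually_eq]
    intro b
    by_cases hb : b ∈ B
    · filter_upwards [ho.mem_nhds hb] with c hcB
      rw [Set.indicator_of_mem hcB, Set.indicator_of_mem hb]
      rfl
    · filter_upwards [hc.isClosed.isOpen_compl.mem_nhds hb] with c hcB
      rw [Set.indicator_of_notMem hcB, Set.indicator_of_notMem hb]⟩

variable {R}

theorem coe_indicatorOf {B : Set (Quiver.Total X)} (ho : IsOpen B) (hc : IsCompact B) :
    (indicatorOf R B ho hc : Quiver.Total X → R) = B.indicator 1 := rfl

end Indicator

section Convolution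

variable {R : Type w} [CommRing R] {X : Type u} [Groupoid.{v} X]

theorem conv_indicator_of_notMem {B : Set (Quiver.Total X)} (g : Quiver.Total X → R)
    {b : Quiver.Total X} (hb : rng b ∉ rng '' B) : conv (B.indicator 1) g b = 0 :=
  finsum_eq_zero_of_forall_eq_zero fun c => by
    rw [Set.indicator_of_notMem fun hc => hb ⟨c.1, hc, c.2⟩, zero_mul]

theorem conv_unit_left (K : Set X) (g : Quiver.Total X → R) :
    conv ((unit '' K).indicator 1) g = (rng ⁻¹' K).indicator g := by
  funext b
  by_cases hb : rng b ∈ K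
  · rw [conv_indicator_of_mem (isBisection_image_unit K) g
      (Set.mem_image_of_mem unit hb) (rng_unit _), Set.indicator_of_mem (by exact hb)]
    exact congrArg g (prod_inv_unit_left b _ rfl)
  · rw [conv_indicator_of_notMem, Set.indicator_of_notMem]
    · exact hb
    · rintro ⟨_, ⟨x, hx, rfl⟩, h⟩
      exact hb (h ▸ hx)

theorem conv_unit_right (K : Set X) (f : Quiver.Total X → R) :
    conv f ((unit '' K).indicator 1) = (src ⁻¹' K).indicator f := by
  classical
  funext b
  rw [conv, finsum_eq_single _ ⟨b, rfl⟩]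
  · have h : prod (inv b) b rfl = unit (src b) := by
      have := prod_inv_self (inv b)
      simp only [inv_inv] at this
      exact this
    simp only
    rw [h]
    by_cases hb : src b ∈ K
    · rw [Set.indicator_of_mem (Set.mem_image_of_mem unit hb), Set.indicator_of_mem (by exact hb)]
      simp
    · rw [Set.indicator_of_notMem, Set.indicator_of_notMem (by exact hb), mul_zero]
      rwa [unit_injective.mem_set_image]
  · intro c hc
    rw [Set.indicator_of_notMem, mul_zero]
    intro h
    exact hc (Subtype.ext (eq_of_prod_inv_mem_range_unit (Set.image_subset_range _ _ h)))

/-- Conjugating the indicator function of a set of units by a bisection. -/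
theorem conv_indicator_conj {B : Set (Quiver.Total X)} (hB : IsBisection B) (K : Set X) :
    conv (B.indicator 1) (conv ((unit '' K).indicator 1) ((inv ⁻¹' B).indicator 1)) =
      ((unit '' (rng '' (B ∩ src ⁻¹' K))).indicator 1 : Quiver.Total X → R) := by
  classical
  funext d
  rw [conv_unit_left]
  by_cases hd : rng d ∈ rng '' B
  · obtain ⟨c, hc, hcd⟩ := hd
    rw [conv_indicator_of_mem hB _ hc hcd, Set.indicator_indicator, Set.indicator_apply,
      Set.indicator_apply]
    congr 1
    refine propext ⟨?_, ?_⟩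
    · rintro ⟨h1, h2⟩
      -- Both arrows lie in `B` and start at `src c`.
      have h3 : inv (prod (inv c) d hcd) = c := hB.1 h2 hc rfl
      exact ⟨rng d, ⟨c, ⟨hc, h1⟩, hcd⟩, (eq_unit_of_inv_prod_inv h3).symm⟩
    · rintro ⟨_, ⟨c', ⟨hc', hK⟩, rfl⟩, rfl⟩
      obtain rfl := hB.2 hc hc' hcd
      refine ⟨hK, ?_⟩
      change inv _ ∈ B
      exact ((congrArg inv (prod_inv_unit c _ hcd)).trans (inv_inv c)).symm ▸ hc
  · rw [conv_indicator_of_notMem _ hd, Set.indicator_of_notMem]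
    rintro ⟨_, ⟨c, ⟨hc, -⟩, rfl⟩, rfl⟩
    exact hd ⟨c, hc, rfl⟩

end Convolution

section UnitIndicator

variable (R : Type w) [CommRing R] {X : Type u} [Groupoid.{v} X]
  [TopologicalSpace X] [TopologicalSpace (Quiver.Total X)] [T2Space (Quiver.Total X)]
  [IsAmple X]

/-- The indicator function of a compact open set of units. -/
noncomputable def unitIndicator (K : Set X) (ho : IsOpen K) (hc : IsCompact K) :
    SteinbergAlgebra R X :=
  indicatorOf R (unit '' K) (isOpenEmbedding_unit.isOpenMap K ho)
    (hc.image IsTopologicalGroupoid.continuous_unit)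

variable {R}

theorem coe_unitIndicator {K : Set X} (ho : IsOpen K) (hc : IsCompact K) :
    (unitIndicator R K ho hc : Quiver.Total X → R) = (unit '' K).indicator 1 := rfl

theorem unitIndicator_apply_unit {K : Set X} (ho : IsOpen K) (hc : IsCompact K) {x : X}
    (hx : x ∈ K) : (unitIndicator R K ho hc : Quiver.Total X → R) (unit x) = 1 := by
  rw [coe_unitIndicator, Set.indicator_of_mem (Set.mem_image_of_mem _ hx), Pi.one_apply]

theorem coe_unitIndicator_mul {K : Set X} (ho : IsOpen K) (hc : IsCompact K)
    (f : SteinbergAlgebra R X) :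
    (unitIndicator R K ho hc * f : SteinbergAlgebra R X) = (rng ⁻¹' K).indicator f.1 := by
  rw [coe_mul]
  exact conv_unit_left K f.1

theorem coe_mul_unitIndicator {K : Set X} (ho : IsOpen K) (hc : IsCompact K)
    (f : SteinbergAlgebra R X) :
    (f * unitIndicator R K ho hc : SteinbergAlgebra R X) = (src ⁻¹' K).indicator f.1 := by
  rw [coe_mul]
  exact conv_unit_right K f.1

/-- Multiplying by the indicator function of a suitable bisection moves a nonzero value
to a unit. -/
theorem exists_mul_apply_unit (f : SteinbergAlgebra R X) (b : Quiver.Total X) :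
    ∃ e : SteinbergAlgebra R X, (e * f : SteinbergAlgebra R X).1 (unit (src b)) = f.1 b := by
  -- Take `B` around `b⁻¹`: at `unit (src b)` the only contributing arrow is `b⁻¹`, and it reads off
  -- `f` at `b`.
  obtain ⟨B, ho, hc, hB, hbB, -⟩ :=
    exists_compact_open_bisection isOpen_univ (Set.mem_univ (inv b))
  refine ⟨indicatorOf R B ho hc, ?_⟩
  rw [coe_mul, coe_indicatorOf,
    conv_indicator_of_mem hB f.1 hbB (b := unit (src b)) rfl]
  exact congrArg f.1 ((prod_inv_unit _ _ rfl).trans (inv_inv b))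

end UnitIndicator

/-! ### Consequences of effectiveness -/

section Uniqueness

variable {R : Type w} [CommRing R] {X : Type u} [Groupoid.{v} X]
  [TopologicalSpace X] [TopologicalSpace (Quiver.Total X)] [IsAmple X]

/-- In an effective groupoid, a bisection without units can be avoided by cutting down to
a smaller open set of units. -/
theorem IsEffective.exists_open_avoiding (heff : IsEffective X) {B : Set (Quiver.Total X)}
    (hBo : IsOpen B) (hB : IsBisection B) (hu : Disjoint B (Set.range unit)) {U : Set X}
    (hU : IsOpen U) (hne : U.Nonempty) :
    ∃ V ⊆ U, IsOpen V ∧ V.Nonempty ∧ ∀ b ∈ B, src b ∈ V → rng b ∉ V := by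
  have : T2Space X := IsEtale.t2_units
  have hs : Continuous (src : Quiver.Total X → X) := IsTopologicalGroupoid.continuous_src
  have hr : Continuous (rng : Quiver.Total X → X) := IsTopologicalGroupoid.continuous_rng
  -- Either some arrow of `B` within `U` moves its source, and Hausdorffness separates the two ends,
  -- or all these arrows form an open set of isotropy, which effectiveness forces into the units.
  by_cases h : ∃ b ∈ B ∩ (src ⁻¹' U ∩ rng ⁻¹' U), rng b ≠ src b
  · obtain ⟨b, ⟨hbB, hbs, hbr⟩, hne'⟩ := h
    obtain ⟨W, V, hW, hV, hbW, hbV, hd⟩ := t2_separation hne'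
    -- By injectivity of `src` on `B`, every arrow of `B` starting in this set ends in `W`, hence
    -- outside `V`.
    refine ⟨(U ∩ V) ∩ src '' (B ∩ rng ⁻¹' W), fun x hx => hx.1.1,
      (hU.inter hV).inter (isOpenMap_src _ (hBo.inter (hW.preimage hr))),
      ⟨src b, ⟨hbs, hbV⟩, b, ⟨hbB, hbW⟩, rfl⟩, ?_⟩
    rintro d hdB ⟨-, b', ⟨hb', hb'W⟩, hb'd⟩ ⟨⟨-, hdV⟩, -⟩
    obtain rfl := hB.1 hb' hdB hb'd
    exact Set.disjoint_left.1 hd hb'W hdV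
  · refine ⟨U, subset_rfl, hU, hne, fun b hb hbs hbr => ?_⟩
    have hsub : B ∩ (src ⁻¹' U ∩ rng ⁻¹' U) ⊆ isotropy X := fun c hc => by
      by_contra hcs
      exact h ⟨c, hc, hcs⟩
    have hint := interior_maximal hsub
      (hBo.inter ((hU.preimage hs).inter (hU.preimage hr))) ⟨hb, hbs, hbr⟩
    rw [heff] at hint
    exact Set.disjoint_left.1 hu hb hint

/-- For one bisection, remove the closed set of units and avoid the rest. Quantifying over all `U`
lets the induction treat a sum by shrinking twice. -/
theorem IsEffective.exists_open_vanishing [T2Space (Quiver.Total X)] (heff : IsEffective X) (f : Quiver.Total X → R)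
    (hf : f ∈ SteinbergAlgebra R X) : ∀ U : Set X, IsOpen U → U.Nonempty →
    ∃ V ⊆ U, IsOpen V ∧ V.Nonempty ∧
      ∀ b, b ∉ Set.range unit → src b ∈ V → rng b ∈ V → f b = 0 := by
  refine induction_bisection (P := fun f => ∀ U : Set X, IsOpen U → U.Nonempty →
    ∃ V ⊆ U, IsOpen V ∧ V.Nonempty ∧
      ∀ b, b ∉ Set.range unit → src b ∈ V → rng b ∈ V → f b = 0) ?_ ?_ ?_ f hf
  · exact fun U hU hne => ⟨U, subset_rfl, hU, hne, fun _ _ _ _ => rfl⟩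
  · intro f _ g _ h1 h2 U hU hne
    obtain ⟨V, hVU, hV, hVne, hfV⟩ := h1 U hU hne
    obtain ⟨W, hWV, hW, hWne, hgW⟩ := h2 V hV hVne
    refine ⟨W, hWV.trans hVU, hW, hWne, fun b hb hs hr => ?_⟩
    rw [Pi.add_apply, hfV b hb (hWV hs) (hWV hr), hgW b hb hs hr, add_zero]
  · intro B hBo _ hB f _ hfB U hU hne
    obtain ⟨V, hVU, hV, hVne, hV'⟩ := heff.exists_open_avoiding
      (hBo.sdiff isClosed_range_unit) (hB.mono Set.sdiff_subset) Set.disjoint_sdiff_left hU hne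
    refine ⟨V, hVU, hV, hVne, fun b hb hs hr => ?_⟩
    by_contra hfb
    exact hV' b ⟨not_imp_comm.1 (hfB b) hfb, hb⟩ hs hr

end Uniqueness

variable {R : Type w} [CommRing R] {X : Type u} [Groupoid.{v} X]

/-- Convolution by a function that is constant on the range fibres gives such a function. -/
theorem conv_comp_rng (g : Quiver.Total X → R) (k : X → R) :
    conv g (k ∘ rng) = (fun x => conv g (k ∘ rng) (unit x)) ∘ rng := by
  funext b
  rfl

variable [TopologicalSpace X] [TopologicalSpace (Quiver.Total X)] [T2Space (Quiver.Total X)]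
  [IsAmple X]

/-! ### Effective and minimal over a field implies simple -/

section Sufficiency

/-- In an effective groupoid over a field, every nonzero ideal contains the indicator function of
a nonempty compact open set of units. -/
theorem IsEffective.exists_unitIndicator_mem (heff : IsEffective X) (hR : IsField R)
    {I : TwoSidedIdeal (SteinbergAlgebra R X)} (hI : I ≠ ⊥) :
    ∃ (K : Set X) (ho : IsOpen K) (hc : IsCompact K), K.Nonempty ∧ unitIndicator R K ho hc ∈ I := by
  have ⟨f, hfI, hf⟩ : ∃ f ∈ I, f ≠ 0 := by
    by_contra! h
    exact hI (le_bot_iff.1 fun f hf => (TwoSidedIdeal.mem_bot _).2 (h f hf))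
  have ⟨b, hb⟩ : ∃ b, f.1 b ≠ 0 := by
    by_contra! h
    exact hf (Subtype.ext (funext h))
  obtain ⟨e, he⟩ := exists_mul_apply_unit f b
  set g := e * f with hg
  obtain ⟨V, hVU, hV, ⟨x, hx⟩, hgV⟩ := heff.exists_open_vanishing g.1 g.2
    {x | g.1 (unit x) = f.1 b}
    ((g.2.1.isOpen_fiber (f.1 b)).preimage IsTopologicalGroupoid.continuous_unit)
    ⟨src b, he⟩
  obtain ⟨K, hKo, hKc, hxK, hKV⟩ := exists_compact_open hV hx
  refine ⟨K, hKo, hKc, ⟨x, hxK⟩, ?_⟩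
  obtain ⟨a, ha⟩ := hR.mul_inv_cancel hb
  -- Compressing `g` to `K` leaves the constant `f.1 b` on the units in `K` and nothing else; `a` is
  -- the inverse of that constant.
  have key : unitIndicator R K hKo hKc =
      ((a • unitIndicator R K hKo hKc) * g) * unitIndicator R K hKo hKc := by
    refine Subtype.ext (funext fun d => ?_)
    rw [coe_mul_unitIndicator, smul_mul_assoc, Submodule.coe_smul, coe_unitIndicator_mul,
      coe_unitIndicator]
    by_cases hd : d ∈ Set.range (unit : X → Quiver.Total X)
    · obtain ⟨y, rfl⟩ := hd
      by_cases hy : y ∈ K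
      · rw [Set.indicator_of_mem (Set.mem_image_of_mem _ hy), Set.indicator_of_mem (by exact hy),
          Pi.smul_apply, Set.indicator_of_mem (by exact hy), (hVU (hKV hy) : g.1 (unit y) = f.1 b),
          smul_eq_mul, mul_comm, ha, Pi.one_apply]
      · rw [Set.indicator_of_notMem (by rwa [unit_injective.mem_set_image]),
          Set.indicator_of_notMem (by exact hy)]
    · rw [Set.indicator_of_notMem fun h => hd (Set.image_subset_range _ _ h)]
      by_cases hs : src d ∈ K
      · rw [Set.indicator_of_mem (by exact hs), Pi.smul_apply]
        by_cases hr : rng d ∈ K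
        · rw [Set.indicator_of_mem (by exact hr), hgV d hd (hKV hs) (hKV hr), smul_zero]
        · rw [Set.indicator_of_notMem (by exact hr), smul_zero]
      · rw [Set.indicator_of_notMem (by exact hs)]
  rw [key]
  exact I.mul_mem_right _ _ (I.mul_mem_left _ _ (I.mul_mem_left _ _ hfI))

/-- The units near which an ideal contains the indicator functions. -/
def idealUnits (I : TwoSidedIdeal (SteinbergAlgebra R X)) : Set X :=
  {x | ∃ (K : Set X) (ho : IsOpen K) (hc : IsCompact K), x ∈ K ∧ unitIndicator R K ho hc ∈ I}

theorem isOpen_idealUnits (I : TwoSidedIdeal (SteinbergAlgebra R X)) : IsOpen (idealUnits I) := by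
  rw [isOpen_iff_forall_mem_open]
  rintro x ⟨K, ho, hc, hx, hI⟩
  exact ⟨K, fun y hy => ⟨K, ho, hc, hy, hI⟩, ho, hx⟩

/-- Conjugating `1_K` by a compact open bisection through `b` gives the indicator of a neighbourhood
of `rng b`, still in `I`. -/
theorem isInvariant_idealUnits (I : TwoSidedIdeal (SteinbergAlgebra R X)) :
    IsInvariant (idealUnits I) := by
  have : T2Space X := IsEtale.t2_units
  rintro b ⟨K, ho, hc, hb, hI⟩
  obtain ⟨B, hBo, hBc, hB, hbB, -⟩ := exists_compact_open_bisection isOpen_univ (Set.mem_univ b)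
  have hs : Continuous (src : Quiver.Total X → X) := IsTopologicalGroupoid.continuous_src
  refine ⟨rng '' (B ∩ src ⁻¹' K), isOpenMap_rng _ (hBo.inter (ho.preimage hs)),
    (hBc.inter_right (hc.isClosed.preimage hs)).image IsTopologicalGroupoid.continuous_rng,
    ⟨b, ⟨hbB, hb⟩, rfl⟩, ?_⟩
  have := I.mul_mem_left (indicatorOf R B hBo hBc) _ (I.mul_mem_right _
    (indicatorOf R (inv ⁻¹' B) (isOpen_preimage_inv hBo) (isCompact_preimage_inv hBc)) hI)
  convert this using 1
  exact Subtype.ext (conv_indicator_conj hB K).symm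

/-- By compactness finitely many sets with indicator in `I` cover `K`. Inclusion–exclusion puts the
indicator of their union `L` in `I`, and `1_K = 1_K * 1_L`. -/
theorem unitIndicator_mem_of_subset_idealUnits {I : TwoSidedIdeal (SteinbergAlgebra R X)}
    {K : Set X} (ho : IsOpen K) (hc : IsCompact K) (h : K ⊆ idealUnits I) :
    unitIndicator R K ho hc ∈ I := by
  classical
  have : T2Space X := IsEtale.t2_units
  have hcover : ∃ (L : Set X) (hLo : IsOpen L) (hLc : IsCompact L), K ⊆ L ∧
      unitIndicator R L hLo hLc ∈ I := by
    refine hc.induction_on (p := fun S => ∃ (L : Set X) (hLo : IsOpen L) (hLc : IsCompact L),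
      S ⊆ L ∧ unitIndicator R L hLo hLc ∈ I) ?_ ?_ ?_ ?_
    · refine ⟨∅, isOpen_empty, isCompact_empty, subset_rfl, ?_⟩
      convert I.zero_mem
      refine Subtype.ext ?_
      rw [coe_unitIndicator, Set.image_empty, Set.indicator_empty]
      rfl
    · rintro s t hst ⟨L, hLo, hLc, hL, hLI⟩
      exact ⟨L, hLo, hLc, hst.trans hL, hLI⟩
    · rintro s t ⟨L, hLo, hLc, hL, hLI⟩ ⟨M, hMo, hMc, hM, hMI⟩
      refine ⟨L ∪ M, hLo.union hMo, hLc.union hMc, Set.union_subset_union hL hM, ?_⟩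
      have key : unitIndicator R (L ∪ M) (hLo.union hMo) (hLc.union hMc) =
          unitIndicator R L hLo hLc + unitIndicator R M hMo hMc -
            unitIndicator R L hLo hLc * unitIndicator R M hMo hMc := by
        refine Subtype.ext (funext fun d => ?_)
        rw [Submodule.coe_sub, Submodule.coe_add, coe_unitIndicator_mul]
        simp only [coe_unitIndicator, Pi.sub_apply, Pi.add_apply]
        by_cases hd : d ∈ Set.range (unit : X → Quiver.Total X)
        · obtain ⟨y, rfl⟩ := hd
          by_cases h1 : y ∈ L <;> by_cases h2 : y ∈ M <;>
            simp [unit_injective.mem_set_image, rng_unit, h1, h2]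
        · have hd' : ∀ S : Set X, d ∉ unit '' S := fun S hS =>
            hd (Set.image_subset_range _ _ hS)
          simp only [Set.indicator_apply, hd', if_false]
          simp
      rw [key]
      exact I.sub_mem (I.add_mem hLI hMI) (I.mul_mem_left _ _ hMI)
    · intro x hx
      obtain ⟨L, hLo, hLc, hxL, hLI⟩ := h hx
      exact ⟨L, mem_nhdsWithin_of_mem_nhds (hLo.mem_nhds hxL), L, hLo, hLc, subset_rfl, hLI⟩
  obtain ⟨L, hLo, hLc, hKL, hLI⟩ := hcover
  have key : unitIndicator R K ho hc = unitIndicator R K ho hc * unitIndicator R L hLo hLc := by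
    refine Subtype.ext (funext fun d => ?_)
    rw [coe_unitIndicator_mul]
    simp only [coe_unitIndicator]
    rw [Set.indicator_indicator]
    congr 1
    ext d
    constructor
    · rintro ⟨y, hy, rfl⟩
      exact ⟨hy, Set.mem_image_of_mem _ (hKL hy)⟩
    · rintro ⟨hd, y, hy, rfl⟩
      exact ⟨y, hd, rfl⟩
  rw [key]
  exact I.mul_mem_left _ _ hLI

/-- Local units: the support of `f` is clopen, so compact, and `f = 1_K * f` for its range image
`K`. -/
theorem eq_top_of_idealUnits_eq_univ {I : TwoSidedIdeal (SteinbergAlgebra R X)}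
    (h : idealUnits I = Set.univ) : I = ⊤ := by
  refine eq_top_iff.2 fun f _ => ?_
  have ho : IsOpen (Function.support f.1) := f.2.1 {0}ᶜ
  have hsupp : tsupport f.1 = Function.support f.1 :=
    IsClosed.closure_eq ⟨by
      rw [Function.compl_support]
      exact f.2.1 {0}⟩
  have hc : IsCompact (Function.support f.1) := hsupp ▸ f.2.2.isCompact
  have hKo := isOpenMap_rng _ ho
  have hKc := hc.image (IsTopologicalGroupoid.continuous_rng (X := X))
  have key : f = unitIndicator R _ hKo hKc * f := by
    refine Subtype.ext ?_
    rw [coe_unitIndicator_mul, Set.indicator_eq_self.2]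
    exact fun b hb => ⟨b, hb, rfl⟩
  rw [key]
  exact I.mul_mem_right _ _
    (unitIndicator_mem_of_subset_idealUnits hKo hKc (h ▸ Set.subset_univ _))

end Sufficiency

variable (R X) in
theorem nontrivial_of_isField [Nonempty X] (hR : IsField R) :
    Nontrivial (SteinbergAlgebra R X) := by
  have := hR.nontrivial
  obtain ⟨K, ho, hc, hx, -⟩ :=
    exists_compact_open isOpen_univ (Set.mem_univ (Classical.arbitrary X))
  refine ⟨unitIndicator R K ho hc, 0, fun h => one_ne_zero (α := R) ?_⟩
  rw [← unitIndicator_apply_unit (R := R) ho hc hx, h]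
  rfl

theorem isSimpleRing_of_isEffective [Nonempty X] (heff : IsEffective X) (hmin : IsMinimal X)
    (hR : IsField R) : IsSimpleRing (SteinbergAlgebra R X) := by
  have := nontrivial_of_isField R X hR
  refine ⟨⟨fun I => or_iff_not_imp_left.2 fun hI => ?_⟩⟩
  obtain ⟨K, ho, hc, ⟨x, hx⟩, hK⟩ := heff.exists_unitIndicator_mem hR hI
  refine eq_top_of_idealUnits_eq_univ ?_
  refine (hmin _ (isOpen_idealUnits I) (isInvariant_idealUnits I)).resolve_left ?_
  exact Set.Nonempty.ne_empty ⟨x, K, ho, hc, hx, hK⟩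

/-! ### Simplicity implies the three conditions -/

section Necessity

variable (R X) in
theorem nontrivial_of_isSimpleRing [IsSimpleRing (SteinbergAlgebra R X)] : Nontrivial R := by
  by_contra h
  rw [not_nontrivial_iff_subsingleton] at h
  obtain ⟨I, J, hIJ⟩ := (IsSimpleRing.simple (R := SteinbergAlgebra R X)).toNontrivial
  have : Subsingleton (SteinbergAlgebra R X) := ⟨fun f g => Subtype.ext (Subsingleton.elim _ _)⟩
  refine hIJ (TwoSidedIdeal.ext fun f => ?_)
  rw [Subsingleton.elim f 0]
  exact iff_of_true I.zero_mem J.zero_mem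

variable (R X) in
-- For `a ≠ 0` the multiples of `a` form a nonzero ideal, so `1_K = a • g` for some `g`; the value
-- of `g` at a unit in `K` inverts `a`.
theorem isField_of_isSimpleRing [Nonempty X] [IsSimpleRing (SteinbergAlgebra R X)] : IsField R := by
  have := nontrivial_of_isSimpleRing R X
  refine ⟨exists_pair_ne R, mul_comm, fun {a} ha => ?_⟩
  let I : TwoSidedIdeal (SteinbergAlgebra R X) :=
    TwoSidedIdeal.mk' {f | ∃ g, a • g = f} ⟨0, smul_zero a⟩
      (by rintro _ _ ⟨f, rfl⟩ ⟨g, rfl⟩; exact ⟨f + g, smul_add a f g⟩)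
      (by rintro _ ⟨f, rfl⟩; exact ⟨-f, smul_neg a f⟩)
      (by rintro f _ ⟨g, rfl⟩; exact ⟨f * g, (mul_smul_comm a f g).symm⟩)
      (by rintro _ f ⟨g, rfl⟩; exact ⟨g * f, (smul_mul_assoc a g f).symm⟩)
  obtain ⟨K, ho, hc, hx, -⟩ :=
    exists_compact_open isOpen_univ (Set.mem_univ (Classical.arbitrary X))
  have hI : I ≠ ⊥ := by
    intro h
    have hmem : a • unitIndicator R K ho hc ∈ I :=
      (TwoSidedIdeal.mem_mk' _ _ _ _ _ _ _).2 ⟨_, rfl⟩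
    rw [h, TwoSidedIdeal.mem_bot] at hmem
    have := congrFun (congrArg Subtype.val hmem) (unit (Classical.arbitrary X))
    rw [Submodule.coe_smul, Pi.smul_apply, unitIndicator_apply_unit ho hc hx, smul_eq_mul,
      mul_one] at this
    exact ha this
  have hmem : unitIndicator R K ho hc ∈ I := by
    rw [(eq_bot_or_eq_top I).resolve_left hI]
    trivial
  obtain ⟨g, hg⟩ := (TwoSidedIdeal.mem_mk' _ _ _ _ _ _ _).1 hmem
  refine ⟨g.1 (unit (Classical.arbitrary X)), ?_⟩
  rw [← unitIndicator_apply_unit (R := R) ho hc hx, ← hg]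
  rfl

variable (R) in
theorem isMinimal_of_isSimpleRing [IsSimpleRing (SteinbergAlgebra R X)] : IsMinimal X := by
  have := nontrivial_of_isSimpleRing R X
  intro U hU hinv
  refine or_iff_not_imp_left.2 fun hne => Set.eq_univ_of_forall fun x => ?_
  obtain ⟨y, hy⟩ := Set.nonempty_iff_ne_empty.2 hne
  have hright : ∀ {b : Quiver.Total X}, rng b ∈ U → src b ∈ U := fun {b} hb => hinv (inv b) hb
  -- The functions supported on arrows with range in `U`. Right multiples preserve ranges; for left
  -- multiples, invariance of `U` is needed.
  let I : TwoSidedIdeal (SteinbergAlgebra R X) :=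
    TwoSidedIdeal.mk' {f | ∀ b, f.1 b ≠ 0 → rng b ∈ U} (fun b hb => absurd rfl hb)
      (by
        intro f g hf hg b hb
        by_contra hbU
        refine hb ?_
        rw [Submodule.coe_add, Pi.add_apply, not_not.1 (mt (hf b) hbU),
          not_not.1 (mt (hg b) hbU), add_zero])
      (fun {f} hf b hb => hf b fun h => hb (by rw [Submodule.coe_neg, Pi.neg_apply, h, neg_zero]))
      (by
        intro f g hg b hb
        rw [coe_mul] at hb
        obtain ⟨c, hc⟩ := not_forall.1 (mt finsum_eq_zero_of_forall_eq_zero hb)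
        have := hinv c.1 (hg _ (right_ne_zero_of_mul hc))
        rwa [c.2] at this)
      (by
        intro f g hf b hb
        rw [coe_mul] at hb
        obtain ⟨c, hc⟩ := not_forall.1 (mt finsum_eq_zero_of_forall_eq_zero hb)
        rw [← c.2]
        exact hf _ (left_ne_zero_of_mul hc))
  obtain ⟨K, ho, hc, hyK, hKU⟩ := exists_compact_open hU hy
  have hI : I ≠ ⊥ := by
    intro h
    have hmem : unitIndicator R K ho hc ∈ I := by
      refine (TwoSidedIdeal.mem_mk' _ _ _ _ _ _ _).2 fun b hb => ?_
      obtain ⟨z, hz, rfl⟩ := Set.mem_of_indicator_ne_zero hb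
      exact hKU hz
    rw [h, TwoSidedIdeal.mem_bot] at hmem
    refine one_ne_zero (α := R) ?_
    rw [← unitIndicator_apply_unit (R := R) ho hc hyK, hmem]
    rfl
  obtain ⟨L, hLo, hLc, hxL, -⟩ := exists_compact_open isOpen_univ (Set.mem_univ x)
  have hmem : unitIndicator R L hLo hLc ∈ I := by
    rw [(eq_bot_or_eq_top I).resolve_left hI]
    trivial
  refine (TwoSidedIdeal.mem_mk' _ _ _ _ _ _ _).1 hmem (unit x) ?_
  rw [unitIndicator_apply_unit hLo hLc hxL]
  exact one_ne_zero

variable (R X) in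
/-- The kernel of the action of the Steinberg algebra on the functions on the unit space. -/
noncomputable def actionKernel : TwoSidedIdeal (SteinbergAlgebra R X) :=
  -- Since `c⁻¹b` has range `src c`, this convolution is `∑ f(c) k(src c)` over arrows `c` into `rng
  -- b`: the action on `k`, with functions on units encoded as `k ∘ rng`.
  TwoSidedIdeal.mk' {f | ∀ k : X → R, conv f.1 (k ∘ rng) = 0}
    (fun k => by
      funext b
      simp [conv])
    (fun {f g} hf hg k => by
      rw [Submodule.coe_add, conv_add_left f.2 g.2, hf, hg, add_zero])
    (fun {f} hf k => by
      have h := conv_add_left (-f).2 f.2 (k ∘ rng)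
      rw [← Submodule.coe_add, neg_add_cancel, hf, add_zero] at h
      rw [← h]
      funext b
      simp [conv])
    (fun {f g} hg k => by
      rw [coe_mul, conv_assoc f.2 g.2, hg]
      funext b
      simp [conv])
    -- `g` sends `k ∘ rng` to another function of this form, which `f` then kills.
    (fun {f g} hf k => by
      rw [coe_mul, conv_assoc f.2 g.2, conv_comp_rng, hf])

theorem mem_actionKernel {f : SteinbergAlgebra R X} :
    f ∈ actionKernel R X ↔ ∀ k : X → R, conv f.1 (k ∘ rng) = 0 :=
  TwoSidedIdeal.mem_mk' _ _ _ _ _ _ _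

/-- The indicator of a nonempty `K` does not kill the constant function 1. -/
theorem actionKernel_ne_top [Nontrivial R] [Nonempty X] : actionKernel R X ≠ ⊤ := by
  intro h
  obtain ⟨K, ho, hc, hx, -⟩ :=
    exists_compact_open isOpen_univ (Set.mem_univ (Classical.arbitrary X))
  have hmem : unitIndicator R K ho hc ∈ actionKernel R X := h ▸ trivial
  have := congrFun (mem_actionKernel.1 hmem 1) (unit (Classical.arbitrary X))
  rw [coe_unitIndicator, conv_unit_left, Set.indicator_of_mem (by exact hx)] at this
  exact one_ne_zero this

variable (R) in
-- A non-unit `b` in the interior of the isotropy lies in a compact open bisection `B` of non-unit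
-- isotropy arrows. Such a `B` fixes every unit it meets, so `1_B` and `1_{r(B)}` act alike although
-- they differ at `b`; yet by simplicity the proper ideal `actionKernel` is zero.
theorem isEffective_of_isSimpleRing [Nonempty X] [IsSimpleRing (SteinbergAlgebra R X)] : IsEffective X := by
  have := nontrivial_of_isSimpleRing R X
  refine subset_antisymm (fun b hb => ?_) (interior_maximal ?_ isOpenEmbedding_unit.isOpen_range)
  swap
  · rintro _ ⟨x, rfl⟩
    rfl
  by_contra hbu
  obtain ⟨B, ho, hc, hB, hbB, hBsub⟩ := exists_compact_open_bisection
    (isOpen_interior.sdiff isClosed_range_unit) (U := interior (isotropy X) \ Set.range unit)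
    ⟨hb, hbu⟩
  have hiso : B ⊆ isotropy X := fun c hc => interior_subset (hBsub hc).1
  have hKo := isOpenMap_rng _ ho
  have hKc := hc.image (IsTopologicalGroupoid.continuous_rng (X := X))
  have hmem : indicatorOf R B ho hc - unitIndicator R (rng '' B) hKo hKc ∈ actionKernel R X := by
    refine mem_actionKernel.2 fun k => ?_
    have h := conv_add_left (indicatorOf R B ho hc - unitIndicator R (rng '' B) hKo hKc).2
      (unitIndicator R (rng '' B) hKo hKc).2 (k ∘ rng)
    rw [← Submodule.coe_add, sub_add_cancel] at h
    refine right_eq_add.1 (Eq.trans ?_ h)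
    rw [coe_unitIndicator, coe_indicatorOf, conv_unit_left]
    funext d
    by_cases hd : rng d ∈ rng '' B
    · rw [Set.indicator_of_mem (by exact hd)]
      obtain ⟨c, hcB, hcd⟩ := hd
      -- Translation by `c` evaluates `k` at `src c`, which equals `rng c = rng d` because `c` is
      -- isotropy.
      rw [conv_indicator_of_mem hB _ hcB hcd, Function.comp_apply, Function.comp_apply, ← hcd,
        show rng c = src c from hiso hcB]
      rfl
    · rw [Set.indicator_of_notMem (by exact hd), conv_indicator_of_notMem _ hd]
  rw [(eq_bot_or_eq_top (actionKernel R X)).resolve_right actionKernel_ne_top,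
    TwoSidedIdeal.mem_bot, sub_eq_zero] at hmem
  have h := congrFun (congrArg Subtype.val hmem) b
  rw [coe_unitIndicator, coe_indicatorOf, Set.indicator_of_mem hbB,
    Set.indicator_of_notMem fun h => hbu (Set.image_subset_range _ _ h)] at h
  exact one_ne_zero h

end Necessity

end AmpleGroupoid

theorem theorem5p2 (X : Type u) [Groupoid.{v} X] [Nonempty X] [TopologicalSpace X]
    [TopologicalSpace (Quiver.Total X)] [T2Space (Quiver.Total X)] [AmpleGroupoid.IsAmple X]
    (R : Type w) [CommRing R] :
    IsSimpleRing (AmpleGroupoid.SteinbergAlgebra R X) ↔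
      AmpleGroupoid.IsEffective X ∧ AmpleGroupoid.IsMinimal X ∧ IsField R :=
  ⟨fun _ => ⟨AmpleGroupoid.isEffective_of_isSimpleRing R,
    AmpleGroupoid.isMinimal_of_isSimpleRing R, AmpleGroupoid.isField_of_isSimpleRing R X⟩,
    fun ⟨heff, hmin, hR⟩ => AmpleGroupoid.isSimpleRing_of_isEffective heff hmin hR⟩
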